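/- For a real number $\nu$ let $$\mathbf H_\nu(z)=\Big(\frac z2\Big)^{\nu+1}\sum_{n\ge 0}\frac{(-1)^n (z/2)^{2n}}{\Gamma(n+\frac32)\,\Gamma(n+\nu+\frac32)}$$ be the Struve function of the first kind (principal branch), and for $|\nu|\le\frac12$ let $$h_\nu(z)=\sqrt{\pi}\,2^{\nu}\,\Gamma\!\left(\nu+\tfrac32\right)z^{\frac{1-\nu}{2}}\,\mathbf H_\nu(\sqrt z) =\frac{\sqrt\pi}{2}\sum_{n\ge0}\frac{(-1)^n\,\Gamma(\nu+\frac32)\,z^{n+1}}{4^n\,\Gamma(n+\frac32)\,\Gamma(\nu+n+\frac32)}$$ be the normalized Struve function. Let $\mathbb D=\{z\in\mathbb C:|z|<1\}$. If $|\nu|\le\frac12$, then $h_\nu$ is starlike in $\mathbb D$, and for every integer $k\ge1$ the derivative $h_\nu^{(k)}$ is close-to-convex in $\mathbb D$. Here a function $f$ analytic in $\mathbb D$ is called starlike in $\mathbb D$ if it is univalent in $\mathbb D$, $f(0)=0$, and $f(\mathbb D)$ is starlike with respect to the origin; it is called close-to-convex in $\mathbb D$ if there is a univalent function $g$ on $\mathbb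 D$ with convex image $g(\mathbb D)$ such that $\operatorname{Re}\big(f'(z)/g'(z)\big)>0$ for all $z\in\mathbb D$. -/

import Mathlib

noncomputable section

/-- The Struve function of the first kind of order `ν` (principal branch), given by
`H_ν(z) = (z/2)^(ν+1) ∑ (-1)^n (z/2)^(2n) / (Γ(n+3/2) Γ(n+ν+3/2))`.
At a pole of `Γ` Mathlib's value is `0`, so that the quotient is `0` there, which agrees with the
convention `1/Γ = 0` at the poles. -/
def struveH (ν z : ℂ) : ℂ :=
  (z / 2) ^ (ν + 1) *
    ∑' n : ℕ, (-1) ^ n * (z / 2) ^ (2 * n) /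
      (Complex.Gamma (n + 3 / 2) * Complex.Gamma (n + ν + 3 / 2))

/-- The normalized Struve function
`h_ν(z) = √π 2^ν Γ(ν+3/2) z^((1-ν)/2) H_ν(√z)`, with principal branches. -/
def normalizedStruve (ν : ℝ) (z : ℂ) : ℂ :=
  (Real.sqrt Real.pi : ℂ) * (2 : ℂ) ^ (ν : ℂ) * Complex.Gamma ((ν : ℂ) + 3 / 2) *
    z ^ ((1 - (ν : ℂ)) / 2) * struveH (ν : ℂ) (z ^ (1 / 2 : ℂ))

/-- The open unit disk in the complex plane. -/
def unitDisk : Set ℂ := Metric.ball 0 1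

/-- `f` is univalent (analytic and injective) in the unit disk. -/
def UnivalentOnDisk (f : ℂ → ℂ) : Prop :=
  DifferentiableOn ℂ f unitDisk ∧ Set.InjOn f unitDisk

/-- `f` is starlike in the unit disk: it is univalent there, `f 0 = 0`, and the image of the
disk is starlike with respect to the origin. -/
def StarlikeOnDisk (f : ℂ → ℂ) : Prop :=
  UnivalentOnDisk f ∧ f 0 = 0 ∧ StarConvex ℝ 0 (f '' unitDisk)

/-- `g` is convex in the unit disk: it is univalent there and the image of the disk is convex. -/
def ConvexOnDisk (g : ℂ → ℂ) : Prop :=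
  UnivalentOnDisk g ∧ Convex ℝ (g '' unitDisk)

/-- `f` is close-to-convex in the unit disk (in the sense of Kaplan): it is analytic there, and
there is a convex univalent `g` such that `Re (f' / g') > 0` in the disk. -/
def CloseToConvexOnDisk (f : ℂ → ℂ) : Prop :=
  DifferentiableOn ℂ f unitDisk ∧
    ∃ g : ℂ → ℂ, ConvexOnDisk g ∧ ∀ z ∈ unitDisk, 0 < (deriv f z / deriv g z).re

end

open scoped Nat

/-! Write `h_ν(z) = z p(z)`. The coefficients of `p` decay so fast that `p` is near `1`, with a
small Lipschitz constant, even for `|z| ≤ 2`. Hence `h_ν - id` is a contraction there: this gives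
injectivity, and Banach's theorem solves `h_ν(w) = t h_ν(z)` with `|w| ≤ 2`. A second use of the
estimates, on the quotient `w / z`, forces `|w| < 1`, which is starlikeness. For close-to-convexity
a linear comparison function suffices: consecutive Taylor coefficients of each `h_ν^(k+1)` shrink by
a factor at least `3`, so this function stays within half of its value at `0`. -/

/-! ### Criteria for starlikeness and close-to-convexity -/

/-- A normalised function `z * p z` with `p` close to `1` in the disk of radius `2` in the `C¹`
sense is starlike in the unit disk. -/
theorem starlikeOnDisk_of_lipschitz {f p : ℂ → ℂ} (hfp : ∀ z, f z = z * p z)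
    (hd : DifferentiableOn ℂ f unitDisk)
    (hp : ∀ z : ℂ, ‖z‖ ≤ 2 → ‖p z - 1‖ ≤ 5 / 27 * ‖z‖)
    (hL : ∀ x y : ℂ, ‖x‖ ≤ 2 → ‖y‖ ≤ 2 → ‖p x - p y‖ ≤ 50 / 243 * ‖x - y‖) :
    StarlikeOnDisk f := by
  have hr : ∀ x y : ℂ, ‖x‖ ≤ 2 → ‖y‖ ≤ 2 →
      ‖(f x - x) - (f y - y)‖ ≤ 190 / 243 * ‖x - y‖ := by
    intro x y hx hy
    have e : (f x - x) - (f y - y) = x * (p x - p y) + (x - y) * (p y - 1) := by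
      rw [hfp, hfp]; ring
    have h1 := hp y hy
    have h2 := hL x y hx hy
    calc ‖(f x - x) - (f y - y)‖ ≤ ‖x‖ * ‖p x - p y‖ + ‖x - y‖ * ‖p y - 1‖ := by
          rw [e, ← norm_mul, ← norm_mul]; exact norm_add_le _ _
      _ ≤ 2 * (50 / 243 * ‖x - y‖) + ‖x - y‖ * (5 / 27 * 2) := by
          gcongr; linarith
      _ = _ := by ring
  have hmem : ∀ z : ℂ, z ∈ unitDisk ↔ ‖z‖ < 1 := fun z => by simp [unitDisk]
  refine ⟨⟨hd, ?_⟩, by simp [hfp], ?_⟩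
  · intro x hx y hy hxy
    rw [hmem] at hx hy
    have h := hr x y (by linarith) (by linarith)
    rw [hxy, show f y - x - (f y - y) = -(x - y) by ring, norm_neg] at h
    have : ‖x - y‖ = 0 := le_antisymm (by linarith) (norm_nonneg _)
    exact sub_eq_zero.1 (norm_eq_zero.1 this)
  · rw [starConvex_zero_iff]
    rintro _ ⟨z, hz, rfl⟩ t ht0 ht1
    rw [hmem] at hz
    rcases eq_or_ne z 0 with rfl | hz0
    · exact ⟨0, by simp [hmem], by simp [hfp]⟩
    have hfz : ‖f z‖ ≤ 32 / 27 := by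
      have h1 := hp z (by linarith)
      have h2 : ‖p z‖ ≤ 32 / 27 := by
        have := norm_add_le (p z - 1) 1
        rw [sub_add_cancel, norm_one] at this
        linarith
      rw [hfp, norm_mul]
      nlinarith [norm_nonneg z, norm_nonneg (p z)]
    -- Fixed points of `F` are the solutions of `f w = t • f z`; the closed 2-disk is preserved
    -- because `32/27 + 20/27 < 2`.
    let F : ℂ → ℂ := fun w => t • f z - (f w - w)
    have hmaps : Set.MapsTo F (Metric.closedBall 0 2) (Metric.closedBall 0 2) := by
      intro w hw
      rw [mem_closedBall_zero_iff] at hw ⊢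
      have h1 : ‖f w - w‖ ≤ 20 / 27 := by
        rw [hfp, show w * p w - w = w * (p w - 1) by ring, norm_mul]
        have := hp w hw
        nlinarith [norm_nonneg w, norm_nonneg (p w - 1)]
      have h2 : ‖t • f z‖ ≤ 32 / 27 := by
        rw [norm_smul, Real.norm_of_nonneg ht0]
        nlinarith [norm_nonneg (f z)]
      have := norm_sub_le (t • f z) (f w - w)
      simp only [F]
      linarith
    have hcontr : ContractingWith (190 / 243) (hmaps.restrict F _ _) := by
      refine ⟨by rw [← NNReal.coe_lt_coe]; norm_num, LipschitzWith.of_dist_le_mul ?_⟩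
      rintro ⟨x, hx⟩ ⟨y, hy⟩
      rw [mem_closedBall_zero_iff] at hx hy
      have := hr x y hx hy
      rw [Subtype.dist_eq, Subtype.dist_eq, dist_eq_norm, dist_eq_norm]
      simp only [Set.MapsTo.val_restrict_apply, F]
      rw [sub_sub_sub_cancel_left, norm_sub_rev]
      simpa using this
    obtain ⟨w, hw, hfix, -⟩ := hcontr.exists_fixedPoint'
      Metric.isClosed_closedBall.isComplete hmaps (x := 0) (by simp) (edist_ne_top _ _)
    rw [mem_closedBall_zero_iff] at hw
    have hfw : f w = t • f z := by
      have : t • f z - (f w - w) = w := hfix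
      linear_combination -this
    refine ⟨w, ?_, hfw⟩
    rw [hmem]
    -- If `|w| ≥ 1 > |z|`, then `v = w / z` has `|v| > 1 ≥ t`, while the two Lipschitz estimates
    -- give `|v - t| ≤ (190/243) |v - t|`.
    by_contra! hw1
    set v := w / z with hv
    have hwv : w = z * v := by rw [hv]; field_simp
    have hv1 : 1 < ‖v‖ := by
      rw [hv, norm_div, one_lt_div (norm_pos_iff.2 hz0)]; linarith
    have heq : v * p w = t * p z := by
      have : z * (v * p w) = z * (t * p z) := by
        rw [← mul_assoc, ← hwv, ← hfp, hfw, hfp, Complex.real_smul]; ring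
      exact mul_left_cancel₀ hz0 this
    have e : v - t = t * (p z - p w) + (t - v) * (p w - 1) := by linear_combination heq
    have htn : ‖(t : ℂ)‖ = t := by rw [Complex.norm_real, Real.norm_of_nonneg ht0]
    have hvt : ‖v‖ - t ≤ ‖v - t‖ := by
      have := norm_sub_norm_le v (t : ℂ)
      rwa [htn] at this
    -- Uses `1 - t < |v| - t ≤ |v - t|`.
    have h1v : ‖z - w‖ ≤ 2 * ‖v - t‖ := by
      have h3 : ‖1 - v‖ ≤ ‖v - t‖ + (1 - t) := by
        have h := norm_sub_le ((1 - t : ℝ) : ℂ) (v - t)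
        rw [Complex.norm_real, Real.norm_of_nonneg (by linarith)] at h
        push_cast at h
        rw [sub_sub_sub_cancel_right] at h
        linarith
      rw [hwv, show z - z * v = z * (1 - v) by ring, norm_mul]
      nlinarith [norm_nonneg (1 - v), norm_nonneg z]
    have hA : ‖(t : ℂ) * (p z - p w)‖ ≤ 100 / 243 * ‖v - t‖ := by
      rw [norm_mul, htn]
      have := hL z w (by linarith) hw
      nlinarith [norm_nonneg (p z - p w)]
    have hB : ‖((t : ℂ) - v) * (p w - 1)‖ ≤ 10 / 27 * ‖v - t‖ := by
      rw [norm_mul, norm_sub_rev]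
      have := hp w hw
      nlinarith [norm_nonneg (v - t)]
    have hC := norm_add_le ((t : ℂ) * (p z - p w)) ((t - v) * (p w - 1))
    rw [← e] at hC
    linarith

/-- If the Taylor coefficients at `0` of `f'` decay at least like `3⁻ⁿ`, relative to the leading
one, then `f` is close-to-convex, with a linear comparison function. -/
theorem closeToConvexOnDisk_of_hasSum {f : ℂ → ℂ} {d : ℕ → ℂ} (hf : DifferentiableOn ℂ f unitDisk)
    (hd0 : d 0 ≠ 0) (hd : ∀ n, ‖d (n + 1)‖ ≤ 1 / 3 * ‖d n‖)
    (hs : ∀ z ∈ unitDisk, HasSum (fun n => d n * z ^ n) (deriv f z)) :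
    CloseToConvexOnDisk f := by
  refine ⟨hf, fun z => d 0 * z, ⟨⟨by fun_prop, ?_⟩, ?_⟩, ?_⟩
  · intro x _ y _ h
    exact mul_left_cancel₀ hd0 h
  · have : (fun z => d 0 * z) = LinearMap.mulLeft ℝ (d 0) := by ext; simp
    rw [this]
    exact (convex_ball _ _).linear_image _
  · intro z hz
    have hz1 : ‖z‖ < 1 := by simpa [unitDisk] using hz
    have hder : deriv (fun z => d 0 * z) z = d 0 := by
      simp
    rw [hder]
    have hpos : 0 < ‖d 0‖ := norm_pos_iff.2 hd0
    have hdec : ∀ n, ‖d n‖ ≤ (1 / 3) ^ n * ‖d 0‖ := by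
      intro n
      induction n with
      | zero => simp
      | succ n ih => rw [pow_succ]; linarith [hd n]
    have h1 : HasSum (fun n => d (n + 1) * z ^ (n + 1)) (deriv f z - d 0) := by
      have := (hasSum_nat_add_iff' 1).2 (hs z hz)
      simpa using this
    have hg : HasSum (fun n : ℕ => (1 / 3 : ℝ) * ‖d 0‖ * (1 / 3) ^ n) (1 / 3 * ‖d 0‖ * (1 - 1 / 3)⁻¹) :=
      (hasSum_geometric_of_lt_one (by norm_num) (by norm_num)).mul_left _
    have h2 : ‖deriv f z - d 0‖ ≤ 1 / 2 * ‖d 0‖ := by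
      rw [← h1.tsum_eq]
      refine (tsum_of_norm_bounded hg fun n => ?_).trans (by norm_num; linarith)
      rw [norm_mul, norm_pow]
      have := hdec (n + 1)
      have hz2 : ‖z‖ ^ (n + 1) ≤ 1 := pow_le_one₀ (norm_nonneg _) hz1.le
      calc ‖d (n + 1)‖ * ‖z‖ ^ (n + 1) ≤ ‖d (n + 1)‖ * 1 := by gcongr
        _ ≤ _ := by rw [pow_succ] at this; linarith
    have h3 : ‖1 - deriv f z / d 0‖ ≤ 1 / 2 := by
      rw [norm_sub_rev, show deriv f z / d 0 - 1 = (deriv f z - d 0) / d 0 by field_simp, norm_div,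
        div_le_iff₀ hpos]
      exact h2
    have h4 := (Complex.re_le_norm _).trans h3
    rw [Complex.sub_re, Complex.one_re] at h4
    linarith

/-! ### Coefficient bounds -/

/-- The absolute value of the coefficient of `z ^ (n + 1)` in the normalized Struve function. -/
noncomputable def struveCoeff (ν : ℝ) (n : ℕ) : ℝ :=
  Real.sqrt Real.pi / 2 * Real.Gamma (ν + 3 / 2) /
    (4 ^ n * (Real.Gamma (n + 3 / 2) * Real.Gamma (n + ν + 3 / 2)))

/-- The quotient `h_ν(z) / z` of the normalized Struve function by the identity. -/
noncomputable def struveQuotient (ν : ℝ) (z : ℂ) : ℂ :=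
  ∑' n : ℕ, (-1) ^ n * (struveCoeff ν n : ℂ) * z ^ n

theorem struveCoeff_zero {ν : ℝ} (hν : |ν| ≤ 1 / 2) : struveCoeff ν 0 = 1 := by
  have h1 := abs_le.1 hν
  have h2 : Real.Gamma (ν + 3 / 2) ≠ 0 := (Real.Gamma_pos_of_pos (by linarith)).ne'
  have h3 : Real.Gamma (3 / 2) = Real.sqrt Real.pi / 2 := by
    rw [show (3 / 2 : ℝ) = 1 / 2 + 1 by norm_num, Real.Gamma_add_one (by norm_num),
      Real.Gamma_one_half_eq]; ring
  have h4 : Real.sqrt Real.pi ≠ 0 := (Real.sqrt_pos.2 Real.pi_pos).ne'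
  simp only [struveCoeff, Nat.cast_zero, zero_add, pow_zero, one_mul, h3]
  exact div_self (mul_ne_zero (div_ne_zero h4 two_ne_zero) h2)

theorem struveCoeff_succ {ν : ℝ} (hν : |ν| ≤ 1 / 2) (n : ℕ) :
    struveCoeff ν (n + 1) = struveCoeff ν n / (4 * (n + 3 / 2) * (n + ν + 3 / 2)) := by
  have h1 := abs_le.1 hν
  have hn : (0 : ℝ) ≤ n := n.cast_nonneg
  have e1 : Real.Gamma ((n + 1 : ℕ) + 3 / 2) = (n + 3 / 2) * Real.Gamma (n + 3 / 2) := by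
    rw [← Real.Gamma_add_one (by linarith)]; congr 1; push_cast; ring
  have e2 : Real.Gamma ((n + 1 : ℕ) + ν + 3 / 2) =
      (n + ν + 3 / 2) * Real.Gamma (n + ν + 3 / 2) := by
    rw [← Real.Gamma_add_one (by linarith)]; congr 1; push_cast; ring
  rw [struveCoeff, struveCoeff, e1, e2, div_div]
  congr 1
  ring

theorem struveCoeff_pos {ν : ℝ} (hν : |ν| ≤ 1 / 2) (n : ℕ) : 0 < struveCoeff ν n := by
  have h1 := abs_le.1 hν
  have hn : (0 : ℝ) ≤ n := n.cast_nonneg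
  have h2 := Real.Gamma_pos_of_pos (s := ν + 3 / 2) (by linarith)
  have h3 := Real.Gamma_pos_of_pos (s := n + 3 / 2) (by linarith)
  have h4 := Real.Gamma_pos_of_pos (s := n + ν + 3 / 2) (by linarith)
  have h5 := Real.sqrt_pos.2 Real.pi_pos
  unfold struveCoeff
  positivity

/-- The worst case is `ν = -1/2`. The divisor is `6` at `n = 0` and at least `20` from `n = 1` on.
-/
theorem struveCoeff_succ_le {ν : ℝ} (hν : |ν| ≤ 1 / 2) (n : ℕ) :
    struveCoeff ν (n + 1) ≤ struveCoeff ν n / (2 * (2 * n + 3) * (n + 1)) := by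
  have h1 := abs_le.1 hν
  rw [struveCoeff_succ hν]
  have := struveCoeff_pos hν n
  have hn : (0 : ℝ) ≤ n := n.cast_nonneg
  apply div_le_div_of_nonneg_left this.le (by positivity)
  nlinarith

theorem struveCoeff_succ_le_geometric {ν : ℝ} (hν : |ν| ≤ 1 / 2) (n : ℕ) :
    struveCoeff ν (n + 1) ≤ 1 / 6 * (1 / 20) ^ n := by
  induction n with
  | zero =>
    have := struveCoeff_succ_le hν 0
    rw [struveCoeff_zero hν] at this
    norm_num at this ⊢
    exact this
  | succ n ih =>
    refine (struveCoeff_succ_le hν (n + 1)).trans ?_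
    have hn : (0 : ℝ) ≤ n := n.cast_nonneg
    have : struveCoeff ν (n + 1) / (2 * (2 * (n + 1 : ℕ) + 3) * ((n + 1 : ℕ) + 1)) ≤
        struveCoeff ν (n + 1) / 20 := by
      apply div_le_div_of_nonneg_left (struveCoeff_pos hν _).le (by norm_num)
      push_cast
      nlinarith
    rw [pow_succ]
    linarith

theorem struveCoeff_le_geometric {ν : ℝ} (hν : |ν| ≤ 1 / 2) (n : ℕ) :
    struveCoeff ν n ≤ 10 / 3 * (1 / 20) ^ n := by
  rcases n with _ | n
  · rw [struveCoeff_zero hν]; norm_num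
  · have := struveCoeff_succ_le_geometric hν n
    rw [pow_succ]
    linarith

theorem norm_neg_one_pow_mul_struveCoeff {ν : ℝ} (hν : |ν| ≤ 1 / 2) (n : ℕ) :
    ‖(-1) ^ n * (struveCoeff ν n : ℂ)‖ = struveCoeff ν n := by
  rw [norm_mul, norm_pow, norm_neg, norm_one, one_pow, one_mul, Complex.norm_real,
    Real.norm_of_nonneg (struveCoeff_pos hν n).le]

/-! ### Estimates for `p` in the disk of radius 2 -/

theorem norm_struveQuotient_term_le {ν : ℝ} (hν : |ν| ≤ 1 / 2) {z : ℂ} (hz : ‖z‖ ≤ 2) (n : ℕ) :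
    ‖(-1) ^ n * (struveCoeff ν n : ℂ) * z ^ n‖ ≤ 10 / 3 * (1 / 10) ^ n := by
  rw [norm_mul, norm_neg_one_pow_mul_struveCoeff hν, norm_pow]
  calc struveCoeff ν n * ‖z‖ ^ n ≤ (10 / 3 * (1 / 20) ^ n) * 2 ^ n := by
        gcongr; exact struveCoeff_le_geometric hν n
    _ = _ := by rw [mul_assoc, ← mul_pow]; norm_num

theorem hasSum_struveQuotient {ν : ℝ} (hν : |ν| ≤ 1 / 2) {z : ℂ} (hz : ‖z‖ ≤ 2) :
    HasSum (fun n : ℕ => (-1) ^ n * (struveCoeff ν n : ℂ) * z ^ n) (struveQuotient ν z) :=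
  (Summable.of_norm_bounded
    ((summable_geometric_of_lt_one (by norm_num) (by norm_num)).mul_left _)
    (norm_struveQuotient_term_le hν hz)).hasSum

theorem norm_struveQuotient_sub_one_le {ν : ℝ} (hν : |ν| ≤ 1 / 2) {z : ℂ} (hz : ‖z‖ ≤ 2) :
    ‖struveQuotient ν z - 1‖ ≤ 5 / 27 * ‖z‖ := by
  have h := (hasSum_nat_add_iff' 1).2 (hasSum_struveQuotient hν hz)
  simp only [Finset.sum_range_one, pow_zero, struveCoeff_zero hν, Complex.ofReal_one,
    mul_one] at h
  have hg : HasSum (fun n : ℕ => (1 / 6 : ℝ) * ‖z‖ * (1 / 10) ^ n)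
      (1 / 6 * ‖z‖ * (1 - 1 / 10)⁻¹) :=
    (hasSum_geometric_of_lt_one (by norm_num) (by norm_num)).mul_left _
  rw [← h.tsum_eq]
  refine (tsum_of_norm_bounded hg fun n => ?_).trans (by norm_num; linarith)
  rw [norm_mul, norm_neg_one_pow_mul_struveCoeff hν, norm_pow, pow_succ]
  calc struveCoeff ν (n + 1) * (‖z‖ ^ n * ‖z‖)
      ≤ (1 / 6 * (1 / 20) ^ n) * (2 ^ n * ‖z‖) := by
        gcongr; exact struveCoeff_succ_le_geometric hν n
    _ = 1 / 6 * ‖z‖ * ((1 / 20) ^ n * 2 ^ n) := by ring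
    _ = _ := by rw [← mul_pow]; norm_num

theorem norm_pow_sub_pow_le_of_norm_le_two {x y : ℂ} (hx : ‖x‖ ≤ 2) (hy : ‖y‖ ≤ 2) (n : ℕ) :
    ‖x ^ n - y ^ n‖ ≤ n * (2 ^ n / 2) * ‖x - y‖ := by
  induction n with
  | zero => simp
  | succ n ih =>
    have e : x ^ (n + 1) - y ^ (n + 1) = x ^ n * (x - y) + (x ^ n - y ^ n) * y := by ring
    calc ‖x ^ (n + 1) - y ^ (n + 1)‖ ≤ ‖x‖ ^ n * ‖x - y‖ + ‖x ^ n - y ^ n‖ * ‖y‖ := by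
          rw [e, ← norm_pow, ← norm_mul, ← norm_mul]; exact norm_add_le _ _
      _ ≤ 2 ^ n * ‖x - y‖ + n * (2 ^ n / 2) * ‖x - y‖ * 2 := by gcongr
      _ = _ := by push_cast; ring

theorem norm_struveQuotient_sub_le {ν : ℝ} (hν : |ν| ≤ 1 / 2) {x y : ℂ} (hx : ‖x‖ ≤ 2)
    (hy : ‖y‖ ≤ 2) : ‖struveQuotient ν x - struveQuotient ν y‖ ≤ 50 / 243 * ‖x - y‖ := by
  have h := (hasSum_struveQuotient hν hx).sub (hasSum_struveQuotient hν hy)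
  have hg : HasSum (fun n : ℕ => (5 / 3 : ℝ) * ‖x - y‖ * (n * (1 / 10) ^ n))
      (5 / 3 * ‖x - y‖ * (1 / 10 / (1 - 1 / 10) ^ 2)) :=
    (hasSum_coe_mul_geometric_of_norm_lt_one (r := (1 / 10 : ℝ))
      (by rw [Real.norm_eq_abs, abs_of_pos] <;> norm_num)).mul_left _
  rw [← h.tsum_eq]
  refine (tsum_of_norm_bounded hg fun n => ?_).trans (by norm_num; linarith)
  rw [← mul_sub, norm_mul, norm_neg_one_pow_mul_struveCoeff hν]
  calc struveCoeff ν n * ‖x ^ n - y ^ n‖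
      ≤ (10 / 3 * (1 / 20) ^ n) * (n * (2 ^ n / 2) * ‖x - y‖) := by
        gcongr
        · exact struveCoeff_le_geometric hν n
        · exact norm_pow_sub_pow_le_of_norm_le_two hx hy n
    _ = 5 / 3 * ‖x - y‖ * (n * ((1 / 20) ^ n * 2 ^ n)) := by ring
    _ = _ := by rw [← mul_pow]; norm_num

/-! ### Principal branches and the factorization `h_ν(z) = z p(z)` -/

/-- Halving the argument keeps it in `(-π, π]`, so no multiple of `2πi` appears, even on the branch
cut. -/
theorem log_sqrt_div_two {z : ℂ} (hz : z ≠ 0) :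
    Complex.log (z ^ (1 / 2 : ℂ) / 2) = Complex.log z / 2 - Complex.log 2 := by
  have hne : z ^ (1 / 2 : ℂ) ≠ 0 := by simp [Complex.cpow_eq_zero_iff, hz]
  have h1 : Complex.log (z ^ (1 / 2 : ℂ)) = Complex.log z / 2 := by
    have hl := Complex.neg_pi_lt_log_im z
    have hu := Complex.log_im_le_pi z
    have him : (Complex.log z * (1 / 2)).im = (Complex.log z).im / 2 := by
      rw [mul_one_div, show (2 : ℂ) = ((2 : ℝ) : ℂ) by norm_num, Complex.div_ofReal_im]
    rw [Complex.cpow_def_of_ne_zero hz, Complex.log_exp, mul_one_div]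
    · rw [him]; linarith [Real.pi_pos]
    · rw [him]; linarith [Real.pi_pos]
  have h2 := Complex.log_mul_ofReal (1 / 2) (by norm_num) (z ^ (1 / 2 : ℂ)) hne
  have h3 : ((Real.log (1 / 2) : ℝ) : ℂ) = -Complex.log 2 := by
    rw [one_div, Real.log_inv, Complex.ofReal_neg, Complex.ofReal_log (by norm_num)]
    norm_num
  rw [h3, h1] at h2
  rw [show z ^ (1 / 2 : ℂ) / 2 = z ^ (1 / 2 : ℂ) * ((1 / 2 : ℝ) : ℂ) by push_cast; ring, h2]
  ring

theorem two_cpow_mul_cpow_mul_sqrt_cpow (ν : ℝ) {z : ℂ} (hz : z ≠ 0) :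
    (2 : ℂ) ^ (ν : ℂ) * z ^ ((1 - (ν : ℂ)) / 2) * (z ^ (1 / 2 : ℂ) / 2) ^ ((ν : ℂ) + 1) =
      z / 2 := by
  have hne : z ^ (1 / 2 : ℂ) / 2 ≠ 0 := by simp [Complex.cpow_eq_zero_iff, hz]
  rw [Complex.cpow_def_of_ne_zero hne, log_sqrt_div_two hz, Complex.cpow_def_of_ne_zero hz,
    Complex.cpow_def_of_ne_zero two_ne_zero, ← Complex.exp_add, ← Complex.exp_add,
    show Complex.log 2 * ν + Complex.log z * ((1 - ν) / 2) +
      (Complex.log z / 2 - Complex.log 2) * (ν + 1) = Complex.log z - Complex.log 2 by ring,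
    Complex.exp_sub, Complex.exp_log hz, Complex.exp_log two_ne_zero]

theorem normalizedStruve_eq {ν : ℝ} (hν : |ν| ≤ 1 / 2) (z : ℂ) :
    normalizedStruve ν z = z * struveQuotient ν z := by
  rcases eq_or_ne z 0 with rfl | hz
  · have h1 := abs_le.1 hν
    have : (1 - (ν : ℂ)) / 2 ≠ 0 := by
      have h : ((1 - ν) / 2 : ℝ) ≠ 0 := by linarith
      exact_mod_cast h
    simp [normalizedStruve, Complex.zero_cpow this]
  have hterm : ∀ n : ℕ, (-1) ^ n * (struveCoeff ν n : ℂ) * z ^ n =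
      Real.sqrt Real.pi / 2 * Complex.Gamma (ν + 3 / 2) *
        ((-1) ^ n * (z ^ (1 / 2 : ℂ) / 2) ^ (2 * n) /
          (Complex.Gamma (n + 3 / 2) * Complex.Gamma (n + ν + 3 / 2))) := by
    intro n
    have hsq : (z ^ (1 / 2 : ℂ)) ^ 2 = z := by
      have := Complex.cpow_nat_inv_pow z (n := 2) two_ne_zero
      rwa [Nat.cast_ofNat, ← one_div] at this
    have g1 : ((Real.Gamma (ν + 3 / 2) : ℝ) : ℂ) = Complex.Gamma (ν + 3 / 2) := by
      rw [← Complex.Gamma_ofReal]; push_cast; rfl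
    have g2 : ((Real.Gamma (n + 3 / 2) : ℝ) : ℂ) = Complex.Gamma (n + 3 / 2) := by
      rw [← Complex.Gamma_ofReal]; push_cast; rfl
    have g3 : ((Real.Gamma (n + ν + 3 / 2) : ℝ) : ℂ) = Complex.Gamma (n + ν + 3 / 2) := by
      rw [← Complex.Gamma_ofReal]; push_cast; rfl
    rw [pow_mul, div_pow, hsq, struveCoeff]
    push_cast
    rw [g1, g2, g3, div_pow]
    norm_num
    ring
  rw [struveQuotient]
  simp only [hterm]
  rw [tsum_mul_left, normalizedStruve, struveH]
  linear_combination (Real.sqrt Real.pi * Complex.Gamma (ν + 3 / 2) *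
    ∑' n : ℕ, (-1) ^ n * (z ^ (1 / 2 : ℂ) / 2) ^ (2 * n) /
      (Complex.Gamma (n + 3 / 2) * Complex.Gamma (n + ν + 3 / 2))) *
    two_cpow_mul_cpow_mul_sqrt_cpow ν hz

/-! ### Taylor coefficients and the derivatives -/

theorem analyticOnNhd_normalizedStruve {ν : ℝ} (hν : |ν| ≤ 1 / 2) :
    AnalyticOnNhd ℂ (normalizedStruve ν) (Metric.ball 0 2) := by
  refine DifferentiableOn.analyticOnNhd ?_ Metric.isOpen_ball
  have hq : DifferentiableOn ℂ (struveQuotient ν) (Metric.ball 0 2) :=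
    Complex.differentiableOn_tsum_of_summable_norm
      ((summable_geometric_of_lt_one (by norm_num) (by norm_num)).mul_left _)
      (fun n => by fun_prop) Metric.isOpen_ball
      fun n w hw => norm_struveQuotient_term_le hν (by simpa using (mem_ball_zero_iff.1 hw).le) n
  exact (differentiableOn_id.mul hq).congr fun z _ => normalizedStruve_eq hν z

theorem iteratedDeriv_succ_normalizedStruve_zero {ν : ℝ} (hν : |ν| ≤ 1 / 2) (n : ℕ) :
    iteratedDeriv (n + 1) (normalizedStruve ν) 0 =
      (n + 1)! * ((-1) ^ n * (struveCoeff ν n : ℂ)) := by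
  -- The factor `z` shifts the coefficients of `p` by one; uniqueness of power series then
  -- identifies them.
  let c : ℕ → ℂ := fun n => n.casesOn 0 fun m => (-1) ^ m * (struveCoeff ν m : ℂ)
  have h1 : HasFPowerSeriesAt (normalizedStruve ν) (FormalMultilinearSeries.ofScalars ℂ c) 0 := by
    rw [hasFPowerSeriesAt_iff]
    filter_upwards [Metric.ball_mem_nhds (0 : ℂ) two_pos] with z hz
    rw [mem_ball_zero_iff] at hz
    rw [zero_add, normalizedStruve_eq hν, ← hasSum_nat_add_iff' 1]
    simp only [FormalMultilinearSeries.coeff_ofScalars, Finset.sum_range_one]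
    convert! (hasSum_struveQuotient hν hz.le).mul_left z using 1
    · ext m
      simp only [c, smul_eq_mul]
      ring
    · simp [c]
  have h2 := ((analyticOnNhd_normalizedStruve hν) 0 (by simp)).hasFPowerSeriesAt
  have h3 := congrArg (fun p => FormalMultilinearSeries.coeff p (n + 1))
    (h1.eq_formalMultilinearSeries h2)
  simp only [FormalMultilinearSeries.coeff_ofScalars] at h3
  have hne : (((n + 1)! : ℕ) : ℂ) ≠ 0 := Nat.cast_ne_zero.2 (Nat.factorial_ne_zero _)
  change (-1) ^ n * (struveCoeff ν n : ℂ) = _ at h3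
  rw [h3]
  field_simp

theorem closeToConvexOnDisk_iteratedDeriv_normalizedStruve {ν : ℝ} (hν : |ν| ≤ 1 / 2) (k : ℕ) :
    CloseToConvexOnDisk (iteratedDeriv k (normalizedStruve ν)) := by
  have hsub : unitDisk ⊆ Metric.ball (0 : ℂ) 2 := Metric.ball_subset_ball (by norm_num)
  have han : ∀ k, DifferentiableOn ℂ (iteratedDeriv k (normalizedStruve ν)) unitDisk := by
    intro k
    rw [iteratedDeriv_eq_iterate]
    exact (((analyticOnNhd_normalizedStruve hν).iterated_deriv k).mono hsub).differentiableOn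
  refine closeToConvexOnDisk_of_hasSum (d := fun n =>
    (n ! : ℂ)⁻¹ * iteratedDeriv (n + k + 1) (normalizedStruve ν) 0) (han k) ?_ ?_ ?_
  · rw [iteratedDeriv_succ_normalizedStruve_zero hν]
    have := (struveCoeff_pos hν (0 + k)).ne'
    simp only [ne_eq, mul_eq_zero, inv_eq_zero, Nat.cast_eq_zero, Complex.ofReal_eq_zero,
      pow_eq_zero_iff', neg_eq_zero, one_ne_zero, Nat.factorial_ne_zero, this, false_and,
      or_self, not_false_eq_true]
  · intro n
    rw [iteratedDeriv_succ_normalizedStruve_zero hν, iteratedDeriv_succ_normalizedStruve_zero hν]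
    simp only [norm_mul _ (_ * (_ * _)), norm_mul (Nat.cast _) _, norm_inv, Complex.norm_natCast,
      norm_neg_one_pow_mul_struveCoeff hν]
    have hc := struveCoeff_succ_le hν (n + k)
    rw [show n + 1 + k = n + k + 1 by ring]
    have hn : (0 : ℝ) < n ! := by exact_mod_cast Nat.factorial_pos n
    have hk : (0 : ℝ) < (n + k + 1)! := by exact_mod_cast Nat.factorial_pos _
    have ha := struveCoeff_pos hν (n + k)
    have hn0 : (0 : ℝ) ≤ n := n.cast_nonneg
    have hk0 : (0 : ℝ) ≤ k := k.cast_nonneg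
    have hfac : ((n + k + 1 + 1)! : ℝ) = (n + k + 2) * (n + k + 1)! := by
      rw [Nat.factorial_succ (n + k + 1)]; push_cast; ring
    have hfac' : ((n + 1)! : ℝ) = (n + 1) * n ! := by
      rw [Nat.factorial_succ]; push_cast; ring
    rw [hfac, hfac']
    calc ((n + 1 : ℝ) * n !)⁻¹ * ((n + k + 2) * (n + k + 1)! * struveCoeff ν (n + k + 1))
        ≤ ((n + 1 : ℝ) * n !)⁻¹ * ((n + k + 2) * (n + k + 1)! *
          (struveCoeff ν (n + k) / (2 * (2 * (n + k : ℕ) + 3) * ((n + k : ℕ) + 1)))) := by gcongr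
      _ = ((n + k + 2) / ((n + 1) * (2 * (2 * (n + k) + 3) * (n + k + 1)))) *
          ((n ! : ℝ)⁻¹ * ((n + k + 1)! * struveCoeff ν (n + k))) := by
          push_cast; field_simp
      _ ≤ _ := by
          -- The ratio equals `1/3` at `n = k = 0`, so the constant is tight here.
          refine mul_le_mul_of_nonneg_right ?_ (by positivity)
          rw [div_le_iff₀ (by positivity)]
          nlinarith [mul_nonneg hn0 hn0, mul_nonneg hn0 hk0, mul_nonneg hk0 hk0,
            mul_nonneg hn0 (by positivity : (0 : ℝ) ≤ 2 * (2 * (n + k) + 3) * (n + k + 1))]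
  · intro z hz
    have h := Complex.hasSum_taylorSeries_on_ball (han (k + 1)) hz
    rw [← iteratedDeriv_succ]
    convert! h using 1
    ext n
    rw [iteratedDeriv_eq_iterate, iteratedDeriv_eq_iterate (n := n), iteratedDeriv_eq_iterate,
      ← Function.iterate_add_apply, sub_zero, smul_eq_mul, smul_eq_mul, ← add_assoc]
    ring

theorem theorem2 (ν : ℝ) (hν : |ν| ≤ 1 / 2) :
    StarlikeOnDisk (normalizedStruve ν) ∧
      ∀ k : ℕ, 1 ≤ k → CloseToConvexOnDisk (iteratedDeriv k (normalizedStruve ν)) := by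
  refine ⟨starlikeOnDisk_of_lipschitz (normalizedStruve_eq hν) ?_
    (fun _ => norm_struveQuotient_sub_one_le hν) (fun _ _ => norm_struveQuotient_sub_le hν),
    fun k _ => closeToConvexOnDisk_iteratedDeriv_normalizedStruve hν k⟩
  exact (analyticOnNhd_normalizedStruve hν).differentiableOn.mono
    (Metric.ball_subset_ball (by norm_num))
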